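/- Let $n\ge 0$ and $K=\lfloor n/2\rfloor$. Let $u(y,t)=\sum_{j=1}^n m_j(t)e^{-|y-x_j(t)|}$ be a globally existing multipeakon of the modified Camassa–Holm equation $m_t+((u^2-u_x^2)m)_x=0$, $m=u-u_{xx}$ (with the singular product $u_x^2m$ read as $\langle u_x^2\rangle m$, where $\langle\cdot\rangle$ is the average of the one-sided limits); that is, for all $t\in\mathbb R$ one has $m_j(t)>0$, $x_1(t)<\dots<x_n(t)$, and $$\dot m_j=0,\qquad \dot x_j=2\sum_{k\ne j}m_jm_ke^{-|x_j-x_k|}+4\sum_{1\le i<j<k\le n}m_im_ke^{-|x_i-x_k|}.$$ At each time $t$ let $h_k=m_ke^{x_k}$, $g_k=m_ke^{-x_k}$, and call $z\in\mathbb C$ an eigenvalue if the solution of $$q_k-q_{k-1}=h_kp_{k-1},\qquad p_k-p_{k-1}=-zg_kq_{k-1}\quad(1\le k\le n),\qquad q_0=0,\ p_0=1,$$ satisfies $p_n=0$ (equivalently, $z$ is an eigenvalue of the boundary value problem $\Phi_x=\begin{bmatrix}0&h\\-zg&0\end{bmatrix}\Phi$, $\Phi_1(-\infty)=\Phi_2(+\infty)=0$,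 with $\Phi$ left continuous, $h=\sum_k h_k\delta_{x_k}$ and $g=\sum_k g_k\delta_{x_k}$). Then there are numbers $0<\zeta_1<\dots<\zeta_K$, independent of $t$, such that for every $t\in\mathbb R$ the set of eigenvalues is exactly $\{\zeta_1,\dots,\zeta_K\}$, the function $u(\cdot,t)$ belongs to $H^1(\mathbb R)$, and $$\|u(\cdot,t)\|_{H^1}^2=\int_{\mathbb R}(u^2+u_x^2)\,dy=2\sum_{j=1}^n m_j^2+4\sum_{j=1}^K\frac1{\zeta_j}.$$ -/

import Mathlib

open MeasureTheory
open scoped ContDiff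

namespace MCHPeakon

/-- `v` is the weak (distributional) derivative of `u` on the real line: both functions are
locally integrable and `∫ u φ' = - ∫ v φ` for all smooth compactly supported `φ`. -/
def HasWeakDeriv (u v : ℝ → ℝ) : Prop :=
  LocallyIntegrable u volume ∧ LocallyIntegrable v volume ∧
    ∀ φ : ℝ → ℝ, ContDiff ℝ ∞ φ → HasCompactSupport φ →
      ∫ y, u y * deriv φ y = -∫ y, v y * φ y

/-- The Sobolev space `H¹(ℝ)`: functions in `L²` with a weak derivative in `L²`. -/
def MemH1 (u : ℝ → ℝ) : Prop :=
  MemLp u 2 volume ∧ ∃ v : ℝ → ℝ, MemLp v 2 volume ∧ HasWeakDeriv u v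

open Classical in
/-- A weak derivative of `u` (unique up to null sets), and `0` if there is none. -/
noncomputable def weakDeriv (u : ℝ → ℝ) : ℝ → ℝ :=
  if h : ∃ v : ℝ → ℝ, HasWeakDeriv u v then h.choose else 0

/-- The `H¹(ℝ)` norm `‖u‖ = (∫ u² + ∫ u_x²)^{1/2}`, meaningful for `u` in `H¹(ℝ)`. -/
noncomputable def h1Norm (u : ℝ → ℝ) : ℝ :=
  Real.sqrt ((∫ y, u y ^ 2) + ∫ y, weakDeriv u y ^ 2)

/-- The peakon ansatz `u(y) = ∑ m_j exp(-|y - x_j|)` with masses `m` and positions `x`. -/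
noncomputable def peakon {n : ℕ} (m x : Fin n → ℝ) (y : ℝ) : ℝ :=
  ∑ j, m j * Real.exp (-|y - x j|)

/-- The velocity of the `j`-th peakon,
`2 ∑_{k ≠ j} m_j m_k exp(-|x_j - x_k|) + 4 ∑_{i < j < k} m_i m_k exp(-|x_i - x_k|)`. -/
noncomputable def velocity {n : ℕ} (m x : Fin n → ℝ) (j : Fin n) : ℝ :=
  2 * ∑ k ∈ Finset.univ.erase j, m j * m k * Real.exp (-|x j - x k|) +
    4 * ∑ i ∈ Finset.Iio j, ∑ k ∈ Finset.Ioi j, m i * m k * Real.exp (-|x i - x k|)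

/-- A globally existing multipeakon of the modified Camassa-Holm equation: positive masses and
strictly ordered positions, defined for all real times, that solve the peakon equations. -/
structure IsGlobalMultipeakon {n : ℕ} (m x : ℝ → Fin n → ℝ) : Prop where
  mass_pos : ∀ t j, 0 < m t j
  ordered : ∀ t, StrictMono (x t)
  mass_ode : ∀ t j, HasDerivAt (fun s => m s j) 0 t
  position_ode : ∀ t j, HasDerivAt (fun s => x s j) (velocity (m t) (x t) j) t

/-- `z` is an eigenvalue of the boundary value problem
`Φ_x = [[0, h], [-z g, 0]] Φ`, `Φ₁(-∞) = Φ₂(+∞) = 0`, with the discrete measures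
`h = ∑ m_k exp(x_k) δ_{x_k}` and `g = ∑ m_k exp(-x_k) δ_{x_k}` (and `Φ` left continuous), in its
difference form for `q_k = Φ₁(x_k+)`, `p_k = Φ₂(x_k+)`, normalized by `p_0 = 1`. The index
`k : Fin n` stands for the step from `k` (`Fin.castSucc`) to `k + 1` (`Fin.succ`). -/
def IsEigenvalue {n : ℕ} (m x : Fin n → ℝ) (z : ℂ) : Prop :=
  ∃ q p : Fin (n + 1) → ℂ,
    q 0 = 0 ∧ p 0 = 1 ∧
    (∀ k : Fin n, q k.succ - q k.castSucc =
      ((m k * Real.exp (x k) : ℝ) : ℂ) * p k.castSucc) ∧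
    (∀ k : Fin n, p k.succ - p k.castSucc =
      -z * ((m k * Real.exp (-x k) : ℝ) : ℂ) * q k.castSucc) ∧
    p (Fin.last n) = 0

/-- The spectrum of the boundary value problem. -/
def bvpSpectrum {n : ℕ} (m x : Fin n → ℝ) : Set ℂ := {z | IsEigenvalue m x z}

end MCHPeakon

/-! ### The transfer recursion and its polynomial form. -/

namespace MCHPeakon

open Polynomial

/-! Both sides reduce to the sum of `h_i g_j` over `i < j`. On the analytic side, `exp(-|y|)` is
twice the Green function of `1 - d²/dy²`, so peaks at `a` and `b` have `H¹` inner product `2 exp(-|a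
- b|)`. By the ordering, an off-diagonal pair contributes `4 h_i g_j`
(`h1Norm_peakon_sq_of_strictMono`). On the spectral side, `p_n` is a polynomial in `z` with constant
term `1` and linear coefficient minus that same sum. Its zeros are positive and simple, because with
`z = l²` the function `l q / p` is of Herglotz type in `l`. There are `⌊n/2⌋` of them by the degree,
and the logarithmic derivative at `0` gives the sum of their reciprocals (`exists_zeros_transfer`).
The zeros do not move: a discrete Lax pair describes the time evolution of `(q_k, p_k)`, and it
leaves `p_n` fixed (`hasDerivAt_transfer`, `transfer_snd_eq_of_evolution`). -/

/-- The pair `(q_k, p_k)` generated by the transfer recursion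
`q_{k+1} = q_k + h_k p_k`, `p_{k+1} = p_k - z g_k q_k` from `(q_0, p_0) = (0, 1)`. -/
def transfer {R : Type*} [CommRing R] (z : R) (h g : ℕ → R) : ℕ → R × R
  | 0 => (0, 1)
  | k + 1 => ((transfer z h g k).1 + h k * (transfer z h g k).2,
      (transfer z h g k).2 - z * g k * (transfer z h g k).1)

section Transfer
variable {R S : Type*} [CommRing R] [CommRing S]

@[simp] lemma transfer_zero (z : R) (h g : ℕ → R) : transfer z h g 0 = (0, 1) := rfl

lemma transfer_succ (z : R) (h g : ℕ → R) (k : ℕ) :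
    transfer z h g (k + 1) = ((transfer z h g k).1 + h k * (transfer z h g k).2,
      (transfer z h g k).2 - z * g k * (transfer z h g k).1) := rfl

lemma map_transfer (φ : R →+* S) (z : R) (h g : ℕ → R) (k : ℕ) :
    transfer (φ z) (fun i => φ (h i)) (fun i => φ (g i)) k =
      (φ (transfer z h g k).1, φ (transfer z h g k).2) := by
  induction k with
  | zero => simp
  | succ k ih => simp [transfer_succ, ih]

end Transfer

/-- The transfer recursion with the spectral parameter as polynomial variable. -/
noncomputable def transferPoly (h g : ℕ → ℝ) (k : ℕ) : ℝ[X] × ℝ[X] :=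
  transfer X (fun i => C (h i)) (fun i => C (g i)) k

/-- The recursion uses only ring operations, so it commutes with the evaluation homomorphism. -/
lemma eval_map_transferPoly (h g : ℕ → ℝ) (k : ℕ) (z : ℂ) :
    (transfer z (fun i => (h i : ℂ)) (fun i => (g i : ℂ)) k).2 =
      ((transferPoly h g k).2.map (algebraMap ℝ ℂ)).eval z := by
  have := map_transfer (eval₂RingHom (algebraMap ℝ ℂ) z) X (fun i => C (h i)) (fun i => C (g i)) k
  simp only [coe_eval₂RingHom, eval₂_X, eval₂_C, Complex.coe_algebraMap] at this
  rw [this, eval_map]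
  rfl

/-! ### Zeros of `p_n`: positivity, simplicity, number, reciprocal sum. -/

section Roots
variable {n : ℕ} {h g : ℕ → ℝ}

/-- Herglotz argument: `Im (l q p̄) ≥ 0` propagates along the recursion and becomes strict after
each step, which forbids `p = 0`. -/
lemma transfer_ne_zero_of_im_pos (hh : ∀ k < n, 0 < h k) (hg : ∀ k < n, 0 < g k)
    {l : ℂ} (hl : 0 < l.im) :
    (transfer (l ^ 2) (fun i => (h i : ℂ)) (fun i => (g i : ℂ)) n).2 ≠ 0 := by
  suffices H : ∀ k ≤ n, ∀ q p : ℂ,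
      transfer (l ^ 2) (fun i => (h i : ℂ)) (fun i => (g i : ℂ)) k = (q, p) →
        0 ≤ (l * q * (starRingEnd ℂ) p).im ∧ p ≠ 0 from (H n le_rfl _ _ rfl).2
  intro k
  induction k with
  | zero =>
    rintro - q p hqp
    obtain ⟨rfl, rfl⟩ := Prod.mk.inj hqp
    simp
  | succ k ih =>
    intro hk q' p' hqp
    rw [transfer_succ] at hqp
    obtain ⟨rfl, rfl⟩ := Prod.mk.inj hqp
    obtain ⟨hS, hp⟩ := ih (by omega) _ _ rfl
    set q := (transfer (l ^ 2) (fun i => (h i : ℂ)) (fun i => (g i : ℂ)) k).1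
    set p := (transfer (l ^ 2) (fun i => (h i : ℂ)) (fun i => (g i : ℂ)) k).2
    have hhk := hh k (by omega)
    have hgk := hg k (by omega)
    have key : (l * (q + h k * p) * (starRingEnd ℂ) (p - l ^ 2 * g k * q)).im =
        (1 + g k * h k * Complex.normSq l) * (l * q * (starRingEnd ℂ) p).im +
          l.im * (h k * Complex.normSq p + g k * Complex.normSq l * Complex.normSq q) := by
      simp [Complex.normSq_apply, pow_two]
      ring
    have hpos : 0 < (l * (q + h k * p) * (starRingEnd ℂ) (p - l ^ 2 * g k * q)).im := by
      rw [key]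
      have h1 := Complex.normSq_pos.2 hp
      have h2 := Complex.normSq_nonneg l
      have h3 := Complex.normSq_nonneg q
      positivity
    refine ⟨hpos.le, fun h0 => ?_⟩
    rw [h0] at hpos
    simp at hpos

lemma transfer_zero_param (h g : ℕ → ℂ) (k : ℕ) : (transfer 0 h g k).2 = 1 := by
  induction k with
  | zero => rfl
  | succ k ih => simp [transfer_succ, ih]

/-- A square root `l` of a zero must be real, since otherwise `l` or `-l` lies in the upper half
plane; and `l ≠ 0` because `p = 1` at `z = 0`. -/
lemma exists_pos_of_transfer_eq_zero (hh : ∀ k < n, 0 < h k) (hg : ∀ k < n, 0 < g k)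
    {z : ℂ} (hz : (transfer z (fun i => (h i : ℂ)) (fun i => (g i : ℂ)) n).2 = 0) :
    ∃ r : ℝ, 0 < r ∧ (r : ℂ) = z := by
  obtain ⟨l, rfl⟩ := IsAlgClosed.exists_pow_nat_eq z (n := 2) (by norm_num)
  rcases lt_trichotomy l.im 0 with hl | hl | hl
  · refine absurd hz ?_
    rw [← neg_sq]
    exact transfer_ne_zero_of_im_pos hh hg (by simpa using hl)
  · have hl' : ((l.re : ℝ) : ℂ) = l := Complex.ext rfl (by simp [hl])
    refine ⟨l.re ^ 2, ?_, by push_cast; rw [hl']⟩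
    have : l.re ≠ 0 := by
      intro h0
      rw [← hl', h0] at hz
      simp [transfer_zero_param] at hz
    positivity
  · exact absurd hz (transfer_ne_zero_of_im_pos hh hg hl)

/-- The tracked quantity `U = q p + 2 z (p q' - q p')` is `p²` times the `l`-derivative of `l q / p`
for `z = l²`. It obeys `U_{k+1} = (1 + z g h) U_k + h p² + z g q²`, so it is positive after the
first step, whereas a double zero of `p` would make it vanish. -/
lemma derivative_transferPoly_ne_zero (hh : ∀ k < n, 0 < h k) (hg : ∀ k < n, 0 < g k)
    {z : ℝ} (hz : 0 < z) (hroot : (transferPoly h g n).2.eval z = 0) :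
    (derivative (transferPoly h g n).2).eval z ≠ 0 := by
  suffices H : ∀ k ≤ n, ∀ q p : ℝ[X], transferPoly h g k = (q, p) →
      (q.eval z ≠ 0 ∨ p.eval z ≠ 0) ∧ (k = 0 ∨ 0 < q.eval z * p.eval z + 2 * z *
        (p.eval z * (derivative q).eval z - q.eval z * (derivative p).eval z)) by
    intro h0
    obtain ⟨-, hn | hU⟩ := H n le_rfl (transferPoly h g n).1 (transferPoly h g n).2 rfl
    · subst hn
      exact absurd hroot (by simp [transferPoly])
    · simp [h0, hroot] at hU
  intro k
  induction k with
  | zero =>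
    rintro - q p hqp
    obtain ⟨rfl, rfl⟩ := Prod.mk.inj hqp
    simp
  | succ k ih =>
    intro hk q' p' hqp
    rw [transferPoly, transfer_succ, ← transferPoly] at hqp
    obtain ⟨rfl, rfl⟩ := Prod.mk.inj hqp
    obtain ⟨hne, hU⟩ := ih (by omega) (transferPoly h g k).1 (transferPoly h g k).2 rfl
    have hU' : 0 ≤ (transferPoly h g k).1.eval z * (transferPoly h g k).2.eval z + 2 * z *
        ((transferPoly h g k).2.eval z * (derivative (transferPoly h g k).1).eval z -
          (transferPoly h g k).1.eval z * (derivative (transferPoly h g k).2).eval z) := by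
      rcases hU with rfl | hU
      · simp [transferPoly]
      · exact hU.le
    simp only [derivative_add, derivative_sub, derivative_mul, derivative_C, derivative_X,
      eval_add, eval_sub, eval_mul, eval_C, eval_X, eval_zero, eval_one]
    generalize eval z (transferPoly h g k).1 = q at *
    generalize eval z (transferPoly h g k).2 = p at *
    generalize eval z (derivative (transferPoly h g k).1) = dq at *
    generalize eval z (derivative (transferPoly h g k).2) = dp at *
    have hhk := hh k (by omega)
    have hgk := hg k (by omega)
    have hsq : 0 < h k * p ^ 2 + z * g k * q ^ 2 := by
      rcases hne with hne | hne <;> positivity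
    have hpos : 0 < (1 + z * g k * h k) * (q * p + 2 * z * (p * dq - q * dp)) +
        (h k * p ^ 2 + z * g k * q ^ 2) := by positivity
    -- The target is `U_{k+1}` exactly as the derivative rules leave it, hence the terms `0 * p` and
    -- `z * 0`.
    have hpos' := hpos.trans_eq (b := (1 + z * g k * h k) * (q * p + 2 * z * (p * dq - q * dp)) +
        (h k * p ^ 2 + z * g k * q ^ 2)) (c := (q + h k * p) * (p - z * g k * q) + 2 * z *
          ((p - z * g k * q) * (dq + (0 * p + h k * dp)) -
            (q + h k * p) * (dp - ((1 * g k + z * 0) * q + z * g k * dq)))) (by ring)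
    refine ⟨?_, Or.inr hpos'⟩
    by_contra! hcon
    rw [hcon.1, hcon.2] at hpos'
    simp at hpos'

lemma coeff_transferPoly_succ_fst (h g : ℕ → ℝ) (k i : ℕ) : (transferPoly h g (k + 1)).1.coeff i =
    (transferPoly h g k).1.coeff i + h k * (transferPoly h g k).2.coeff i := by
  rw [transferPoly, transfer_succ, ← transferPoly]; simp

lemma coeff_transferPoly_succ_snd_zero (h g : ℕ → ℝ) (k : ℕ) :
    (transferPoly h g (k + 1)).2.coeff 0 = (transferPoly h g k).2.coeff 0 := by
  rw [transferPoly, transfer_succ, ← transferPoly]; simp [mul_assoc]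

lemma coeff_transferPoly_succ_snd_succ (h g : ℕ → ℝ) (k i : ℕ) :
    (transferPoly h g (k + 1)).2.coeff (i + 1) =
      (transferPoly h g k).2.coeff (i + 1) - g k * (transferPoly h g k).1.coeff i := by
  rw [transferPoly, transfer_succ, ← transferPoly]; simp [mul_assoc, coeff_X_mul]

/-- `(-1)^i` times the `i`-th coefficient is positive exactly up to the degree. -/
lemma coeff_transferPoly (hh : ∀ k < n, 0 < h k) (hg : ∀ k < n, 0 < g k) :
    ∀ k ≤ n, ∀ i,
      ((2 * i + 1 ≤ k → 0 < (-1) ^ i * (transferPoly h g k).1.coeff i) ∧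
        (k < 2 * i + 1 → (transferPoly h g k).1.coeff i = 0)) ∧
      ((2 * i ≤ k → 0 < (-1) ^ i * (transferPoly h g k).2.coeff i) ∧
        (k < 2 * i → (transferPoly h g k).2.coeff i = 0)) := by
  intro k
  induction k with
  | zero =>
    rintro - i
    refine ⟨⟨by omega, by simp [transferPoly]⟩, fun hi => ?_, fun hi => ?_⟩
    · obtain rfl : i = 0 := by omega
      simp [transferPoly]
    · simp [transferPoly, coeff_one]; omega
  | succ k ih =>
    intro hk i
    have hhk := hh k (by omega)
    have hgk := hg k (by omega)
    have ih := ih (by omega)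
    refine ⟨?_, ?_⟩
    · rw [coeff_transferPoly_succ_fst]
      obtain ⟨⟨h1, h2⟩, h3, h4⟩ := ih i
      refine ⟨fun hi => ?_, fun hi => ?_⟩
      · have := mul_pos hhk (h3 (by omega))
        -- Either the old coefficient is zero (a new top degree) or both summands carry the sign
        -- `(-1)^i`; nothing cancels.
        rcases lt_or_ge k (2 * i + 1) with hc | hc
        · rw [h2 hc]; linarith
        · have := h1 hc
          linarith
      · rw [h2 (by omega), h4 (by omega)]; ring
    · cases i with
      | zero =>
        rw [coeff_transferPoly_succ_snd_zero]
        exact ⟨fun _ => (ih 0).2.1 (by omega), by omega⟩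
      | succ i =>
        rw [coeff_transferPoly_succ_snd_succ]
        obtain ⟨h3, h4⟩ := (ih (i + 1)).2
        obtain ⟨h1, h2⟩ := (ih i).1
        refine ⟨fun hi => ?_, fun hi => ?_⟩
        · have := mul_pos hgk (h1 (by omega))
          rw [pow_succ] at h3 ⊢
          rcases lt_or_ge k (2 * (i + 1)) with hc | hc
          · rw [h4 hc]; linarith
          · have := h3 hc
            linarith
        · rw [h4 (by omega), h2 (by omega)]; ring

lemma natDegree_transferPoly (hh : ∀ k < n, 0 < h k) (hg : ∀ k < n, 0 < g k) :
    (transferPoly h g n).2.natDegree = n / 2 := by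
  have H := coeff_transferPoly hh hg n le_rfl
  refine natDegree_eq_of_le_of_coeff_ne_zero ?_ ?_
  · refine natDegree_le_iff_coeff_eq_zero.2 fun i hi => (H i).2.2 (by omega)
  · intro h0
    have := (H (n / 2)).2.1 (by omega)
    simp [h0] at this

lemma coeff_zero_transferPoly (h g : ℕ → ℝ) (k : ℕ) :
    (transferPoly h g k).1.coeff 0 = ∑ i ∈ Finset.range k, h i ∧
      (transferPoly h g k).2.coeff 0 = 1 := by
  induction k with
  | zero => simp [transferPoly]
  | succ k ih =>
    rw [coeff_transferPoly_succ_fst, coeff_transferPoly_succ_snd_zero, ih.1, ih.2,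
      Finset.sum_range_succ, mul_one]
    exact ⟨rfl, rfl⟩

lemma coeff_one_transferPoly (h g : ℕ → ℝ) (k : ℕ) :
    (transferPoly h g k).2.coeff 1 =
      -∑ j ∈ Finset.range k, g j * ∑ i ∈ Finset.range j, h i := by
  induction k with
  | zero => simp [transferPoly, coeff_one]
  | succ k ih =>
    rw [coeff_transferPoly_succ_snd_succ, ih, (coeff_zero_transferPoly h g k).1,
      Finset.sum_range_succ]
    ring

/-- The zeros of `p_n` are `⌊n/2⌋` distinct positive numbers, and their reciprocals sum to
`∑_{i < j} h_i g_j`. -/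
lemma exists_zeros_transfer (hh : ∀ k < n, 0 < h k) (hg : ∀ k < n, 0 < g k) :
    ∃ ζ : Fin (n / 2) → ℝ, (∀ j, 0 < ζ j) ∧ StrictMono ζ ∧
      {z : ℂ | (transfer z (fun i => (h i : ℂ)) (fun i => (g i : ℂ)) n).2 = 0} =
        Set.range (fun j => (ζ j : ℂ)) ∧
      ∑ j, 1 / ζ j = ∑ j ∈ Finset.range n, g j * ∑ i ∈ Finset.range j, h i := by
  set P : ℝ[X] := (transferPoly h g n).2 with hP
  set Q : ℂ[X] := P.map (algebraMap ℝ ℂ) with hQ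
  have hP0 : P.coeff 0 = 1 := (coeff_zero_transferPoly h g n).2
  have hPne : P ≠ 0 := by
    intro h0; simp [h0] at hP0
  have hQne : Q ≠ 0 := (Polynomial.map_ne_zero_iff (algebraMap ℝ ℂ).injective).2 hPne
  have hreal : ∀ z ∈ Q.roots, ∃ r : ℝ, 0 < r ∧ (r : ℂ) = z := fun z hz => by
    refine exists_pos_of_transfer_eq_zero hh hg ?_
    rw [eval_map_transferPoly]
    exact (mem_roots hQne).1 hz
  have hnodup : Q.roots.Nodup := by
    rw [Multiset.nodup_iff_count_le_one]
    intro z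
    by_contra! hc
    rw [count_roots, one_lt_rootMultiplicity_iff_isRoot hQne] at hc
    obtain ⟨r, hr, rfl⟩ := hreal z ((mem_roots hQne).2 hc.1)
    have ev : ∀ (p : ℝ[X]), (p.map (algebraMap ℝ ℂ)).IsRoot (r : ℂ) → p.eval r = 0 := by
      intro p hp
      have := hp.eq_zero
      rw [← Complex.coe_algebraMap, eval_map_algebraMap, aeval_algebraMap_apply] at this
      simpa using this
    refine derivative_transferPoly_ne_zero hh hg hr (ev _ hc.1) (ev _ ?_)
    rw [← derivative_map]; exact hc.2
  have hsplit : Q.Splits := IsAlgClosed.splits Q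
  have hcard : Q.roots.card = n / 2 := by
    rw [← natDegree_transferPoly hh hg, ← hP, ← natDegree_map (p := P) (algebraMap ℝ ℂ)]
    exact hsplit.natDegree_eq_card_roots.symm
  -- The roots are real, so taking real parts loses nothing and lets them be listed in increasing
  -- order.
  have hinj : Set.InjOn Complex.re (Q.roots.toFinset : Set ℂ) := by
    intro a ha b hb hab
    obtain ⟨r, -, rfl⟩ := hreal a (by simpa using ha)
    obtain ⟨s, -, rfl⟩ := hreal b (by simpa using hb)
    simpa using hab
  set s : Finset ℝ := Q.roots.toFinset.image Complex.re with hs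
  have hscard : s.card = n / 2 := by
    rw [hs, Finset.card_image_of_injOn hinj, Multiset.toFinset_card_of_nodup hnodup, hcard]
  have hmem : ∀ r : ℝ, r ∈ s ↔ (r : ℂ) ∈ Q.roots := by
    intro r
    rw [hs, Finset.mem_image]
    constructor
    · rintro ⟨z, hz, rfl⟩
      obtain ⟨r, -, rfl⟩ := hreal z (by simpa using hz)
      simpa using hz
    · intro hr
      exact ⟨r, by simpa using hr, by simp⟩
  refine ⟨s.orderEmbOfFin hscard, fun j => ?_, (s.orderEmbOfFin hscard).strictMono, ?_, ?_⟩
  · obtain ⟨r, hr, hrz⟩ := hreal _ ((hmem _).1 (s.orderEmbOfFin_mem hscard j))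
    rwa [← Complex.ofReal_injective hrz]
  · ext z
    rw [Set.mem_ofPred_eq, Set.mem_range, eval_map_transferPoly]
    constructor
    · intro hz
      have hz' : z ∈ Q.roots := (mem_roots hQne).2 hz
      obtain ⟨r, -, rfl⟩ := hreal z hz'
      have : r ∈ Set.range (s.orderEmbOfFin hscard) := by
        rw [Finset.range_orderEmbOfFin]; exact (hmem r).2 hz'
      obtain ⟨j, hj⟩ := this
      exact ⟨j, by rw [hj]⟩
    · rintro ⟨j, rfl⟩
      exact (mem_roots hQne).1 ((hmem _).1 (s.orderEmbOfFin_mem hscard j))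
  · have hsum : ∑ j, 1 / s.orderEmbOfFin hscard j = ∑ r ∈ s, 1 / r := by
      conv_rhs => rw [← Finset.map_orderEmbOfFin_univ s hscard, Finset.sum_map]
      rfl
    have hQ0 : Q.eval 0 = 1 := by
      rw [← coeff_zero_eq_eval_zero, hQ, coeff_map, hP0, map_one]
    have hdQ : (derivative Q).eval 0 = ((P.coeff 1 : ℝ) : ℂ) := by
      rw [← coeff_zero_eq_eval_zero, coeff_derivative, hQ, coeff_map]; simp
    -- `Q'(0) / Q(0)` is the sum of `1 / (0 - ζ)` over the roots, and `Q(0) = 1`.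
    have hlog := hsplit.eval_derivative_div_eval_of_ne_zero (x := 0) (by rw [hQ0]; exact one_ne_zero)
    rw [hQ0, hdQ, div_one] at hlog
    have hroots : (Q.roots.map fun z => 1 / (0 - z)).sum = ∑ z ∈ Q.roots.toFinset, 1 / (0 - z) := by
      rw [Finset.sum_multiset_map_count]
      refine Finset.sum_congr rfl fun z hz => ?_
      rw [Multiset.count_eq_one_of_mem hnodup (by simpa using hz), one_smul]
    rw [hroots] at hlog
    rw [hsum, hs, Finset.sum_image hinj]
    have h1 : P.coeff 1 = -∑ z ∈ Q.roots.toFinset, 1 / z.re := by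
      apply Complex.ofReal_injective
      rw [hlog]
      push_cast
      rw [← Finset.sum_neg_distrib]
      refine Finset.sum_congr rfl fun z hz => ?_
      obtain ⟨r, -, rfl⟩ := hreal z (by simpa using hz)
      simp [inv_neg]
    rw [hP, coeff_one_transferPoly] at h1
    linarith

end Roots

end MCHPeakon

/-! ### Isospectrality of the peakon flow. -/

namespace MCHPeakon

/-- Time half of the Lax pair, with `A` the sum of `h` to the left of the gap and `B` the sum of `g`
to its right. The induction step is the zero-curvature condition, which holds for exactly this
velocity `w`. The diagonal entries are shifted by a multiple of the identity so that the initial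
vector `(0, 1)`, where `A = 0`, stays fixed. -/
lemma hasDerivAt_transfer {n : ℕ} {h g : ℕ → ℝ → ℂ} {t : ℝ} {w : ℕ → ℂ}
    (hh : ∀ k < n, HasDerivAt (h k) (w k * h k t) t)
    (hg : ∀ k < n, HasDerivAt (g k) (-w k * g k t) t)
    (hw : ∀ k < n, w k = 4 * (∑ i ∈ Finset.range k, h i t) * (∑ i ∈ Finset.Ico (k + 1) n, g i t) +
      2 * g k t * (∑ i ∈ Finset.range k, h i t) +
      2 * h k t * ∑ i ∈ Finset.Ico (k + 1) n, g i t)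
    {z : ℂ} (hz : z ≠ 0) :
    ∀ k ≤ n, ∀ A B q p, A = ∑ i ∈ Finset.range k, h i t → B = ∑ i ∈ Finset.Ico k n, g i t →
      (q, p) = transfer z (fun i => h i t) (fun i => g i t) k →
      HasDerivAt (fun s => (transfer z (fun i => h i s) (fun i => g i s) k).1)
        ((2 * A * B + 2 / z) * q - 2 * A / z * p) t ∧
      HasDerivAt (fun s => (transfer z (fun i => h i s) (fun i => g i s) k).2)
        (2 * B * q - 2 * A * B * p) t := by
  intro k
  induction k with
  | zero =>
    rintro - A B q p hA - hqp
    obtain ⟨rfl, rfl⟩ := Prod.mk.inj hqp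
    simp only [Finset.range_zero, Finset.sum_empty] at hA
    subst hA
    simp [hasDerivAt_const]
  | succ k ih =>
    intro hk A' B' q' p' hA' hB' hqp
    rw [transfer_succ] at hqp
    obtain ⟨rfl, rfl⟩ := Prod.mk.inj hqp
    have hhk := hh k (by omega)
    have hgk := hg k (by omega)
    have hwk := hw k (by omega)
    obtain ⟨hq, hp⟩ := ih (by omega) _ _ _ _ rfl rfl rfl
    rw [Finset.sum_range_succ] at hA'
    rw [Finset.sum_eq_sum_Ico_succ_bot (by omega : k < n), ← hB'] at hq hp
    rw [← hB'] at hwk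
    generalize ∑ i ∈ Finset.range k, h i t = A at *
    set q := (transfer z (fun i => h i t) (fun i => g i t) k).1 with hqdef
    set p := (transfer z (fun i => h i t) (fun i => g i t) k).2 with hpdef
    simp only [transfer_succ]
    refine ⟨?_, ?_⟩
    · refine HasDerivAt.congr_deriv (hq.add (hhk.mul hp)) ?_
      rw [← hpdef, hwk, hA']
      field_simp
      ring
    · refine HasDerivAt.congr_deriv (hp.sub ((hgk.const_mul z).mul hq)) ?_
      rw [← hqdef, hwk, hA']
      field_simp
      ring

lemma transfer_snd_eq_of_evolution {n : ℕ} {h g : ℕ → ℝ → ℂ} {w : ℕ → ℝ → ℂ}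
    (hh : ∀ t, ∀ k < n, HasDerivAt (h k) (w k t * h k t) t)
    (hg : ∀ t, ∀ k < n, HasDerivAt (g k) (-w k t * g k t) t)
    (hw : ∀ t, ∀ k < n, w k t =
      4 * (∑ i ∈ Finset.range k, h i t) * (∑ i ∈ Finset.Ico (k + 1) n, g i t) +
      2 * g k t * (∑ i ∈ Finset.range k, h i t) +
      2 * h k t * ∑ i ∈ Finset.Ico (k + 1) n, g i t)
    (z : ℂ) (s t : ℝ) :
    (transfer z (fun i => h i s) (fun i => g i s) n).2 =
      (transfer z (fun i => h i t) (fun i => g i t) n).2 := by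
  -- The Lax matrix has a pole at `z = 0`, but there `p` is identically `1`.
  rcases eq_or_ne z 0 with rfl | hz
  · rw [transfer_zero_param, transfer_zero_param]
  have H : ∀ t, HasDerivAt (fun s => (transfer z (fun i => h i s) (fun i => g i s) n).2) 0 t := by
    intro t
    -- At `k = n` the sum `B` is empty, and both terms of the derivative of `p` contain `B`.
    simpa using (hasDerivAt_transfer (hh t) (hg t) (hw t) hz n le_rfl _ _ _ _ rfl rfl rfl).2
  exact is_const_of_deriv_eq_zero (fun t => (H t).differentiableAt) (fun t => (H t).deriv) s t

/-- Extension of a finite sequence by zero. -/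
def extendZero {R : Type*} [Zero R] {n : ℕ} (f : Fin n → R) (k : ℕ) : R :=
  if hk : k < n then f ⟨k, hk⟩ else 0

section ExtendZero
variable {n : ℕ}

@[simp] lemma extendZero_val {R : Type*} [Zero R] (f : Fin n → R) (k : Fin n) :
    extendZero f k = f k := by
  simp [extendZero]

lemma sum_range_extendZero (f : Fin n → ℝ) (j : Fin n) :
    ∑ i ∈ Finset.range j, extendZero f i = ∑ i ∈ Finset.Iio j, f i := by
  rw [← Nat.Iio_eq_range, ← Fin.map_valEmbedding_Iio, Finset.sum_map]
  simp

lemma sum_Ico_extendZero (f : Fin n → ℝ) (j : Fin n) :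
    ∑ i ∈ Finset.Ico (j + 1 : ℕ) n, extendZero f i = ∑ i ∈ Finset.Ioi j, f i := by
  have : Finset.Ico (j + 1 : ℕ) n = (Finset.Ioi j).map Fin.valEmbedding := by
    ext i
    simp only [Finset.mem_Ico, Finset.mem_map, Finset.mem_Ioi, Fin.valEmbedding_apply]
    constructor
    · rintro ⟨h1, h2⟩
      exact ⟨⟨i, h2⟩, Fin.lt_def.2 (by simpa using h1), rfl⟩
    · rintro ⟨a, ha, rfl⟩
      exact ⟨Fin.lt_def.1 ha, a.2⟩
  rw [this, Finset.sum_map]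
  simp

lemma isEigenvalue_iff (m x : Fin n → ℝ) (z : ℂ) :
    IsEigenvalue m x z ↔
      (transfer z (fun i => ((extendZero (fun k => m k * Real.exp (x k)) i : ℝ) : ℂ))
        (fun i => ((extendZero (fun k => m k * Real.exp (-x k)) i : ℝ) : ℂ)) n).2 = 0 := by
  set h : Fin n → ℝ := fun k => m k * Real.exp (x k) with hh
  set g : Fin n → ℝ := fun k => m k * Real.exp (-x k) with hg
  constructor
  · rintro ⟨q, p, hq0, hp0, hq, hp, hlast⟩
    have H : ∀ k : Fin (n + 1), transfer z (fun i => ((extendZero h i : ℝ) : ℂ))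
        (fun i => ((extendZero g i : ℝ) : ℂ)) k = (q k, p k) := by
      intro k
      induction k using Fin.induction with
      | zero => simp [hq0, hp0]
      | succ k ih =>
        rw [Fin.val_castSucc] at ih
        rw [Fin.val_succ, transfer_succ, ih, extendZero_val, extendZero_val, hh, hg]
        ext1
        · linear_combination -hq k
        · linear_combination -hp k
    have := H (Fin.last n)
    rw [Fin.val_last] at this
    rw [this, ← hlast]
  · intro h0
    refine ⟨fun k => (transfer z (fun i => ((extendZero h i : ℝ) : ℂ))
        (fun i => ((extendZero g i : ℝ) : ℂ)) k).1, fun k => (transfer z (fun i => ((extendZero h i : ℝ) : ℂ))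
        (fun i => ((extendZero g i : ℝ) : ℂ)) k).2, by simp, by simp, fun k => ?_, fun k => ?_, ?_⟩
    · simp only [Fin.val_succ, Fin.val_castSucc, transfer_succ, extendZero_val]
      ring
    · simp only [Fin.val_succ, Fin.val_castSucc, transfer_succ, extendZero_val]
      ring
    · simpa using h0

/-- The ordering resolves the absolute values, so each exponential splits as `exp(x_i) exp(-x_k)`
and the double sum factors. -/
lemma velocity_eq (m : Fin n → ℝ) {x : Fin n → ℝ} (hx : StrictMono x) (j : Fin n) :
    velocity m x j =
      4 * (∑ i ∈ Finset.Iio j, m i * Real.exp (x i)) *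
          (∑ k ∈ Finset.Ioi j, m k * Real.exp (-x k)) +
        2 * (m j * Real.exp (-x j)) * (∑ i ∈ Finset.Iio j, m i * Real.exp (x i)) +
        2 * (m j * Real.exp (x j)) * ∑ k ∈ Finset.Ioi j, m k * Real.exp (-x k) := by
  have hsplit : Finset.univ.erase j = Finset.Iio j ∪ Finset.Ioi j := by
    ext k; simp
  have hdisj : Disjoint (Finset.Iio j) (Finset.Ioi j) :=
    Finset.disjoint_left.2 fun k h1 h2 => by
      rw [Finset.mem_Iio] at h1; rw [Finset.mem_Ioi] at h2; exact lt_asymm h1 h2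
  have hexp : ∀ {a b : Fin n}, a < b →
      Real.exp (-|x a - x b|) = Real.exp (x a) * Real.exp (-x b) := by
    intro a b hab
    rw [← Real.exp_add, abs_of_neg (sub_neg.2 (hx hab))]
    congr 1; ring
  have h1 : ∑ k ∈ Finset.Iio j, m j * m k * Real.exp (-|x j - x k|) =
      (m j * Real.exp (-x j)) * ∑ i ∈ Finset.Iio j, m i * Real.exp (x i) := by
    rw [Finset.mul_sum]
    refine Finset.sum_congr rfl fun k hk => ?_
    rw [abs_sub_comm, hexp (Finset.mem_Iio.1 hk)]; ring
  have h2 : ∑ k ∈ Finset.Ioi j, m j * m k * Real.exp (-|x j - x k|) =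
      (m j * Real.exp (x j)) * ∑ k ∈ Finset.Ioi j, m k * Real.exp (-x k) := by
    rw [Finset.mul_sum]
    refine Finset.sum_congr rfl fun k hk => ?_
    rw [hexp (Finset.mem_Ioi.1 hk)]; ring
  have h3 : ∑ i ∈ Finset.Iio j, ∑ k ∈ Finset.Ioi j, m i * m k * Real.exp (-|x i - x k|) =
      (∑ i ∈ Finset.Iio j, m i * Real.exp (x i)) *
        ∑ k ∈ Finset.Ioi j, m k * Real.exp (-x k) := by
    rw [Finset.sum_mul_sum]
    refine Finset.sum_congr rfl fun i hi => Finset.sum_congr rfl fun k hk => ?_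
    rw [hexp ((Finset.mem_Iio.1 hi).trans (Finset.mem_Ioi.1 hk))]; ring
  rw [velocity, hsplit, Finset.sum_union hdisj, h1, h2, h3]
  ring

end ExtendZero

lemma IsGlobalMultipeakon.bvpSpectrum_eq {n : ℕ} {m x : ℝ → Fin n → ℝ}
    (hmx : IsGlobalMultipeakon m x) (s t : ℝ) :
    bvpSpectrum (m s) (x s) = bvpSpectrum (m t) (x t) := by
  ext z
  simp only [bvpSpectrum, Set.mem_ofPred_eq, isEigenvalue_iff]
  rw [transfer_snd_eq_of_evolution
    (h := fun k t => ((extendZero (fun i => m t i * Real.exp (x t i)) k : ℝ) : ℂ))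
    (g := fun k t => ((extendZero (fun i => m t i * Real.exp (-x t i)) k : ℝ) : ℂ))
    (w := fun k t => ((extendZero (velocity (m t) (x t)) k : ℝ) : ℂ)) ?_ ?_ ?_ z s t]
  · intro t k hk
    obtain ⟨j, rfl⟩ : ∃ j : Fin n, (j : ℕ) = k := ⟨⟨k, hk⟩, rfl⟩
    simp only [extendZero_val]
    refine HasDerivAt.congr_deriv (((hmx.mass_ode t j).mul (hmx.position_ode t j).exp).ofReal_comp) ?_
    push_cast
    ring
  · intro t k hk
    obtain ⟨j, rfl⟩ : ∃ j : Fin n, (j : ℕ) = k := ⟨⟨k, hk⟩, rfl⟩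
    simp only [extendZero_val]
    refine HasDerivAt.congr_deriv (((hmx.mass_ode t j).mul (hmx.position_ode t j).neg.exp).ofReal_comp) ?_
    simp only [Pi.neg_apply]
    push_cast
    ring
  · intro t k hk
    obtain ⟨j, rfl⟩ : ∃ j : Fin n, (j : ℕ) = k := ⟨⟨k, hk⟩, rfl⟩
    have h1 := sum_range_extendZero (fun i => m t i * Real.exp (x t i)) j
    have h2 := sum_Ico_extendZero (fun i => m t i * Real.exp (-x t i)) j
    simp only [extendZero_val]
    rw [velocity_eq _ (hmx.ordered t), ← h1, ← h2]
    push_cast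
    ring

end MCHPeakon

/-! ### Weak derivatives. -/

namespace MCHPeakon

section WeakDerivative

lemma HasWeakDeriv.ae_eq {u v w : ℝ → ℝ} (hv : HasWeakDeriv u v) (hw : HasWeakDeriv u w) :
    v =ᵐ[volume] w := by
  refine ae_eq_of_integral_contDiff_smul_eq hv.2.1 hw.2.1 fun φ hφ hc => ?_
  have h1 := hv.2.2 φ hφ hc
  have h2 := hw.2.2 φ hφ hc
  simp only [smul_eq_mul, mul_comm (φ _)]
  linarith

/-- Lets an explicit weak derivative replace the chosen one under the integral. -/
lemma HasWeakDeriv.weakDeriv_ae_eq {u v : ℝ → ℝ} (hv : HasWeakDeriv u v) :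
    weakDeriv u =ᵐ[volume] v := by
  have h : ∃ v, HasWeakDeriv u v := ⟨v, hv⟩
  rw [weakDeriv, dif_pos h]
  exact h.choose_spec.ae_eq hv

lemma integrable_mul_of_hasCompactSupport {u φ : ℝ → ℝ} (hu : LocallyIntegrable u volume)
    (hφ : Continuous φ) (hc : HasCompactSupport φ) : Integrable (fun y => u y * φ y) := by
  simpa only [smul_eq_mul, mul_comm] using hu.integrable_smul_left_of_hasCompactSupport hφ hc

lemma HasWeakDeriv.sum {ι : Type*} (s : Finset ι) (c : ι → ℝ) {u v : ι → ℝ → ℝ}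
    (h : ∀ i ∈ s, HasWeakDeriv (u i) (v i)) :
    HasWeakDeriv (fun y => ∑ i ∈ s, c i * u i y) (fun y => ∑ i ∈ s, c i * v i y) := by
  refine ⟨?_, ?_, fun φ hφ hc => ?_⟩
  · have := locallyIntegrable_finsetSum s (f := fun i => c i • u i) (μ := volume)
      fun i hi => (h i hi).1.smul (c i)
    convert! this using 1
  · have := locallyIntegrable_finsetSum s (f := fun i => c i • v i) (μ := volume)
      fun i hi => (h i hi).2.1.smul (c i)
    convert! this using 1
  · simp only [Finset.sum_mul, mul_assoc]
    rw [integral_finsetSum, integral_finsetSum, ← Finset.sum_neg_distrib]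
    · refine Finset.sum_congr rfl fun i hi => ?_
      rw [integral_const_mul, integral_const_mul, (h i hi).2.2 φ hφ hc, mul_neg]
    · exact fun i hi => (integrable_mul_of_hasCompactSupport (h i hi).2.1 hφ.continuous hc).const_mul _
    · exact fun i hi => (integrable_mul_of_hasCompactSupport (h i hi).1
        (hφ.continuous_deriv (by simp)) hc.deriv).const_mul _

end WeakDerivative

/-! ### The `H¹` norm of a multipeakon. -/

/-- The weak derivative of `y ↦ exp (-|y - a|)`, with left-continuous representative. -/
noncomputable def peakonDeriv (a y : ℝ) : ℝ :=
  if y ≤ a then Real.exp (y - a) else -Real.exp (a - y)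

section Peakon

lemma exp_neg_abs_of_le {a y : ℝ} (h : y ≤ a) : Real.exp (-|y - a|) = Real.exp (y - a) := by
  rw [abs_of_nonpos (by linarith), neg_neg]

lemma exp_neg_abs_of_lt {a y : ℝ} (h : a < y) : Real.exp (-|y - a|) = Real.exp (a - y) := by
  rw [abs_of_pos (by linarith), neg_sub]

lemma peakonDeriv_of_le {a y : ℝ} (h : y ≤ a) : peakonDeriv a y = Real.exp (y - a) := if_pos h

lemma peakonDeriv_of_lt {a y : ℝ} (h : a < y) : peakonDeriv a y = -Real.exp (a - y) :=
  if_neg h.not_ge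

lemma abs_peakonDeriv (a y : ℝ) : |peakonDeriv a y| = Real.exp (-|y - a|) := by
  rcases le_or_gt y a with h | h
  · rw [peakonDeriv_of_le h, exp_neg_abs_of_le h, Real.abs_exp]
  · rw [peakonDeriv_of_lt h, exp_neg_abs_of_lt h, abs_neg, Real.abs_exp]

lemma measurable_peakonDeriv (a : ℝ) : Measurable (peakonDeriv a) :=
  Measurable.ite measurableSet_Iic (by fun_prop) (by fun_prop)

lemma integrableOn_exp_add_Iic (c a : ℝ) {r : ℝ} (hr : 0 < r) :
    IntegrableOn (fun y => Real.exp (r * y + c)) (Set.Iic a) := by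
  simp only [Real.exp_add]
  exact (integrableOn_exp_mul_Iic hr a).mul_const _

lemma integrableOn_exp_add_Ioi (c a : ℝ) {r : ℝ} (hr : r < 0) :
    IntegrableOn (fun y => Real.exp (r * y + c)) (Set.Ioi a) := by
  simp only [Real.exp_add]
  exact (integrableOn_exp_mul_Ioi hr a).mul_const _

lemma integrable_exp_neg_abs (a : ℝ) : Integrable (fun y : ℝ => Real.exp (-|y - a|)) := by
  rw [← integrableOn_univ, ← Set.Iic_union_Ioi (a := a)]
  refine IntegrableOn.union ?_ ?_
  · refine (integrableOn_exp_add_Iic (-a) a one_pos).congr_fun (fun y hy => ?_) measurableSet_Iic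
    simp only [exp_neg_abs_of_le (Set.mem_Iic.1 hy)]; congr 1; ring
  · refine (integrableOn_exp_add_Ioi a a (r := -1) (by norm_num)).congr_fun (fun y hy => ?_)
      measurableSet_Ioi
    simp only [exp_neg_abs_of_lt (Set.mem_Ioi.1 hy)]; congr 1; ring

lemma integrable_peakonDeriv (a : ℝ) : Integrable (peakonDeriv a) := by
  refine (integrable_exp_neg_abs a).mono' (measurable_peakonDeriv a).aestronglyMeasurable
    (Filter.Eventually.of_forall fun y => ?_)
  rw [Real.norm_eq_abs, abs_peakonDeriv]

lemma integrable_exp_neg_abs_mul (a b : ℝ) :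
    Integrable (fun y : ℝ => Real.exp (-|y - a|) * Real.exp (-|y - b|)) := by
  refine (integrable_exp_neg_abs a).mul_bdd (c := 1)
    (integrable_exp_neg_abs b).aestronglyMeasurable (Filter.Eventually.of_forall fun y => ?_)
  rw [Real.norm_eq_abs, Real.abs_exp, Real.exp_le_one_iff]
  exact neg_nonpos.2 (abs_nonneg _)

lemma integrable_peakonDeriv_mul (a b : ℝ) :
    Integrable (fun y : ℝ => peakonDeriv a y * peakonDeriv b y) := by
  refine (integrable_peakonDeriv a).mul_bdd (c := 1)
    (integrable_peakonDeriv b).aestronglyMeasurable (Filter.Eventually.of_forall fun y => ?_)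
  rw [Real.norm_eq_abs, abs_peakonDeriv, Real.exp_le_one_iff]
  exact neg_nonpos.2 (abs_nonneg _)

lemma hasWeakDeriv_exp_neg_abs (a : ℝ) :
    HasWeakDeriv (fun y => Real.exp (-|y - a|)) (peakonDeriv a) := by
  refine ⟨(integrable_exp_neg_abs a).locallyIntegrable,
    (integrable_peakonDeriv a).locallyIntegrable, fun φ hφ hc => ?_⟩
  have hφ1 : ContDiff ℝ 1 φ := hφ.of_le (by simp)
  have hdφ : ∀ y, HasDerivAt φ (deriv φ y) y := fun y =>
    (hφ1.differentiable one_ne_zero y).hasDerivAt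
  have i1 := integrable_mul_of_hasCompactSupport (integrable_exp_neg_abs a).locallyIntegrable
    (hφ.continuous_deriv (by simp)) hc.deriv
  have i2 := integrable_mul_of_hasCompactSupport (integrable_peakonDeriv a).locallyIntegrable
    hφ.continuous hc
  have i3 : Integrable (fun y => Real.exp (-|y - a|) * deriv φ y + peakonDeriv a y * φ y) :=
    i1.add i2
  -- On each side of the peak the integrand is an exact derivative; the boundary terms `φ a` and `-φ
  -- a` cancel.
  rw [eq_neg_iff_add_eq_zero, ← integral_add i1 i2,
    ← intervalIntegral.integral_Iic_add_Ioi (b := a) i3.integrableOn i3.integrableOn]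
  have hL : ∫ y in Set.Iic a, (Real.exp (-|y - a|) * deriv φ y + peakonDeriv a y * φ y) = φ a := by
    have hf : ContDiff ℝ 1 (fun y => Real.exp (y - a) * φ y) := by fun_prop
    have := (hc.mul_left (f := fun y => Real.exp (y - a))).integral_Iic_deriv_eq hf a
    simp only [sub_self, Real.exp_zero, one_mul] at this
    rw [← this]
    refine setIntegral_congr_fun measurableSet_Iic fun y hy => ?_
    have hy : y ≤ a := hy
    have hd := (((hasDerivAt_id y).sub_const a).exp.mul (hdφ y)).deriv
    simp only [exp_neg_abs_of_le hy, peakonDeriv_of_le hy]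
    refine Eq.trans ?_ hd.symm
    simp; ring
  have hR : ∫ y in Set.Ioi a, (Real.exp (-|y - a|) * deriv φ y + peakonDeriv a y * φ y) =
      -φ a := by
    have hf : ContDiff ℝ 1 (fun y => Real.exp (a - y) * φ y) := by fun_prop
    have := (hc.mul_left (f := fun y => Real.exp (a - y))).integral_Ioi_deriv_eq hf a
    simp only [sub_self, Real.exp_zero, one_mul] at this
    rw [← this]
    refine setIntegral_congr_fun measurableSet_Ioi fun y hy => ?_
    have hy : a < y := hy
    have hd := (((hasDerivAt_id y).const_sub a).exp.mul (hdφ y)).deriv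
    simp only [exp_neg_abs_of_lt hy, peakonDeriv_of_lt hy]
    refine Eq.trans ?_ hd.symm
    simp; ring
  rw [hL, hR, add_neg_cancel]

/-- Between the peaks the two products cancel because the slopes have opposite signs; each outer
half-line contributes `exp(a - b)`. -/
lemma integral_peakon_pair_of_le {a b : ℝ} (hab : a ≤ b) :
    ∫ y, (Real.exp (-|y - a|) * Real.exp (-|y - b|) + peakonDeriv a y * peakonDeriv b y) =
      2 * Real.exp (-|a - b|) := by
  have hi : Integrable (fun y : ℝ => Real.exp (-|y - a|) * Real.exp (-|y - b|) +
      peakonDeriv a y * peakonDeriv b y) :=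
    (integrable_exp_neg_abs_mul a b).add (integrable_peakonDeriv_mul a b)
  rw [← intervalIntegral.integral_Iic_add_Ioi (b := b) hi.integrableOn hi.integrableOn]
  have hR : ∫ y in Set.Ioi b, (Real.exp (-|y - a|) * Real.exp (-|y - b|) +
      peakonDeriv a y * peakonDeriv b y) = Real.exp (a - b) := by
    have : ∫ y in Set.Ioi b, (Real.exp (-|y - a|) * Real.exp (-|y - b|) +
        peakonDeriv a y * peakonDeriv b y) =
        ∫ y in Set.Ioi b, 2 * Real.exp (a + b) * Real.exp (-2 * y) := by
      refine setIntegral_congr_fun measurableSet_Ioi fun y hy => ?_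
      have hb : b < y := hy
      have ha : a < y := hab.trans_lt hb
      simp only [exp_neg_abs_of_lt hb, peakonDeriv_of_lt hb, exp_neg_abs_of_lt ha,
        peakonDeriv_of_lt ha, neg_mul_neg, mul_assoc, ← Real.exp_add]
      rw [← two_mul]; congr 2; ring
    rw [this, integral_const_mul, integral_exp_mul_Ioi (by norm_num)]
    rw [neg_div_neg_eq, mul_div_assoc', mul_assoc, mul_div_cancel_left₀ _ two_ne_zero,
      ← Real.exp_add]
    congr 1; ring
  have hL : ∫ y in Set.Iic b, (Real.exp (-|y - a|) * Real.exp (-|y - b|) +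
      peakonDeriv a y * peakonDeriv b y) = Real.exp (a - b) := by
    have : ∫ y in Set.Iic b, (Real.exp (-|y - a|) * Real.exp (-|y - b|) +
        peakonDeriv a y * peakonDeriv b y) =
        ∫ y in Set.Iic b, (Set.Iic a).indicator
          (fun y => 2 * Real.exp (-(a + b)) * Real.exp (2 * y)) y := by
      refine setIntegral_congr_fun measurableSet_Iic fun y hy => ?_
      have hb : y ≤ b := hy
      rcases le_or_gt y a with ha | ha
      · rw [Set.indicator_of_mem (Set.mem_Iic.2 ha)]
        simp only [exp_neg_abs_of_le hb, peakonDeriv_of_le hb, exp_neg_abs_of_le ha,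
          peakonDeriv_of_le ha, mul_assoc, ← Real.exp_add]
        rw [← two_mul]; congr 2; ring
      · rw [Set.indicator_of_notMem (by simpa using ha)]
        simp only [exp_neg_abs_of_le hb, peakonDeriv_of_le hb, exp_neg_abs_of_lt ha,
          peakonDeriv_of_lt ha]
        ring
    rw [this, setIntegral_indicator measurableSet_Iic, Set.Iic_inter_Iic, min_eq_right hab,
      integral_const_mul, integral_exp_mul_Iic (by norm_num)]
    rw [mul_div_assoc', mul_assoc, mul_div_cancel_left₀ _ two_ne_zero, ← Real.exp_add]
    congr 1; ring
  rw [hL, hR, exp_neg_abs_of_le hab, two_mul]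

lemma integral_peakon_pair (a b : ℝ) :
    (∫ y, Real.exp (-|y - a|) * Real.exp (-|y - b|)) + (∫ y, peakonDeriv a y * peakonDeriv b y) =
      2 * Real.exp (-|a - b|) := by
  rw [← integral_add (integrable_exp_neg_abs_mul a b) (integrable_peakonDeriv_mul a b)]
  rcases le_total a b with h | h
  · exact integral_peakon_pair_of_le h
  · rw [abs_sub_comm, ← integral_peakon_pair_of_le h]
    simp only [mul_comm]

variable {n : ℕ} (m x : Fin n → ℝ)

lemma hasWeakDeriv_peakon :
    HasWeakDeriv (peakon m x) (fun y => ∑ j, m j * peakonDeriv (x j) y) :=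
  HasWeakDeriv.sum Finset.univ m fun j _ => hasWeakDeriv_exp_neg_abs (x j)

lemma memLp_exp_neg_abs (a : ℝ) : MemLp (fun y : ℝ => Real.exp (-|y - a|)) 2 := by
  rw [memLp_two_iff_integrable_sq (integrable_exp_neg_abs a).aestronglyMeasurable]
  simpa only [sq] using integrable_exp_neg_abs_mul a a

lemma memLp_peakonDeriv (a : ℝ) : MemLp (peakonDeriv a) 2 := by
  rw [memLp_two_iff_integrable_sq (integrable_peakonDeriv a).aestronglyMeasurable]
  simpa only [sq] using integrable_peakonDeriv_mul a a

lemma memH1_peakon : MemH1 (peakon m x) :=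
  ⟨memLp_finsetSum _ fun j _ => (memLp_exp_neg_abs (x j)).const_mul (m j), _,
    memLp_finsetSum _ fun j _ => (memLp_peakonDeriv (x j)).const_mul (m j),
    hasWeakDeriv_peakon m x⟩

lemma integral_sum_sq (f : Fin n → ℝ → ℝ) (hf : ∀ i j, Integrable fun y => f i y * f j y) :
    ∫ y, (∑ j, m j * f j y) ^ 2 = ∑ i, ∑ j, m i * m j * ∫ y, f i y * f j y := by
  have : ∀ y, (∑ j, m j * f j y) ^ 2 = ∑ i, ∑ j, m i * m j * (f i y * f j y) := fun y => by
    rw [sq, Finset.sum_mul_sum]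
    exact Finset.sum_congr rfl fun i _ => Finset.sum_congr rfl fun j _ => by ring
  simp only [this]
  rw [integral_finsetSum _ fun i _ => integrable_finsetSum _ fun j _ => (hf i j).const_mul _]
  refine Finset.sum_congr rfl fun i _ => ?_
  rw [integral_finsetSum _ fun j _ => (hf i j).const_mul _]
  exact Finset.sum_congr rfl fun j _ => integral_const_mul _ _

lemma h1Norm_peakon_sq :
    h1Norm (peakon m x) ^ 2 = ∑ i, ∑ j, m i * m j * (2 * Real.exp (-|x i - x j|)) := by
  rw [h1Norm, Real.sq_sqrt (add_nonneg (integral_nonneg fun y => sq_nonneg _)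
    (integral_nonneg fun y => sq_nonneg _))]
  have hw : ∫ y, weakDeriv (peakon m x) y ^ 2 = ∫ y, (∑ j, m j * peakonDeriv (x j) y) ^ 2 :=
    integral_congr_ae ((hasWeakDeriv_peakon m x).weakDeriv_ae_eq.fun_comp (· ^ 2))
  rw [hw, integral_sum_sq m _ fun i j => integrable_peakonDeriv_mul _ _]
  simp only [peakon]
  rw [integral_sum_sq m (fun j y => Real.exp (-|y - x j|))
    fun i j => integrable_exp_neg_abs_mul _ _, ← Finset.sum_add_distrib]
  refine Finset.sum_congr rfl fun i _ => ?_
  rw [← Finset.sum_add_distrib]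
  refine Finset.sum_congr rfl fun j _ => ?_
  rw [← mul_add, integral_peakon_pair]

lemma h1Norm_peakon_sq_of_strictMono {x : Fin n → ℝ} (hx : StrictMono x) :
    h1Norm (peakon m x) ^ 2 = 2 * ∑ j, m j ^ 2 +
      4 * ∑ j, m j * Real.exp (-x j) * ∑ i ∈ Finset.Iio j, m i * Real.exp (x i) := by
  have hoff := Finset.sum_sum_Ioi_add_eq_sum_sum_off_diag
    (fun i j => m i * m j * (2 * Real.exp (-|x i - x j|)))
  have hdiag : ∀ i, ∑ j, m i * m j * (2 * Real.exp (-|x i - x j|)) =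
      2 * m i ^ 2 + ∑ j ∈ {i}ᶜ, m j * m i * (2 * Real.exp (-|x j - x i|)) := fun i => by
    rw [← Finset.add_sum_erase _ _ (Finset.mem_univ i), Finset.compl_singleton]
    congr 1
    · simp; ring
    · refine Finset.sum_congr rfl fun j _ => ?_
      rw [abs_sub_comm]; ring
  rw [h1Norm_peakon_sq, Finset.sum_congr rfl fun i _ => hdiag i, Finset.sum_add_distrib, ← hoff,
    ← Finset.mul_sum, Finset.mul_sum (a := 4)]
  congr 1
  have hswap : ∀ j, 4 * (m j * Real.exp (-x j) * ∑ i ∈ Finset.Iio j, m i * Real.exp (x i)) =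
      ∑ i ∈ Finset.Iio j, 4 * (m j * Real.exp (-x j) * (m i * Real.exp (x i))) := fun j => by
    rw [Finset.mul_sum, Finset.mul_sum]
  rw [Finset.sum_congr rfl fun j _ => hswap j]
  refine Eq.trans ?_ (Finset.sum_comm' (s := Finset.univ) (s' := fun j => Finset.Ioi j)
    (t := fun j => Finset.Iio j) (t' := Finset.univ) (by simp)).symm
  refine Finset.sum_congr rfl fun i _ => Finset.sum_congr rfl fun j hj => ?_
  have hij := hx (Finset.mem_Ioi.1 hj)
  rw [abs_sub_comm (x j), exp_neg_abs_of_le hij.le, sub_eq_add_neg, Real.exp_add]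
  ring

end Peakon

/-! ### Conclusion. -/

/-- At a fixed time the spectrum consists of `⌊n/2⌋` distinct positive numbers, whose reciprocals
sum to `∑_{i < j} h_i g_j`. -/
lemma exists_bvpSpectrum_eq {n : ℕ} {m : Fin n → ℝ} (hm : ∀ j, 0 < m j) (x : Fin n → ℝ) :
    ∃ ζ : Fin (n / 2) → ℝ, (∀ j, 0 < ζ j) ∧ StrictMono ζ ∧
      bvpSpectrum m x = Set.range (fun j => (ζ j : ℂ)) ∧
      ∑ j, 1 / ζ j =
        ∑ j, m j * Real.exp (-x j) * ∑ i ∈ Finset.Iio j, m i * Real.exp (x i) := by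
  have hpos : ∀ s : ℝ → ℝ, ∀ k < n, 0 < extendZero (fun j => m j * Real.exp (s (x j))) k := by
    intro s k hk
    simp only [extendZero, hk, dif_pos]
    exact mul_pos (hm _) (Real.exp_pos _)
  -- `id` gives the weights `h` and `Neg.neg` the weights `g`.
  obtain ⟨ζ, h1, h2, h3, h4⟩ := exists_zeros_transfer (hpos id) (hpos Neg.neg)
  refine ⟨ζ, h1, h2, ?_, ?_⟩
  · rw [← h3]
    ext z
    exact isEigenvalue_iff m x z
  · rw [h4, Finset.sum_range]
    refine Finset.sum_congr rfl fun j _ => ?_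
    rw [extendZero_val, sum_range_extendZero]
    rfl

end MCHPeakon

theorem corollary6p6 (n : ℕ) (m x : ℝ → Fin n → ℝ)
    (hmx : MCHPeakon.IsGlobalMultipeakon m x) :
    ∃ ζ : Fin (n / 2) → ℝ, (∀ j, 0 < ζ j) ∧ StrictMono ζ ∧
      ∀ t : ℝ,
        MCHPeakon.bvpSpectrum (m t) (x t) = Set.range (fun j => (ζ j : ℂ)) ∧
        MCHPeakon.MemH1 (MCHPeakon.peakon (m t) (x t)) ∧
        MCHPeakon.h1Norm (MCHPeakon.peakon (m t) (x t)) ^ 2 =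
          2 * ∑ j, m t j ^ 2 + 4 * ∑ j, 1 / ζ j := by
  obtain ⟨ζ, hpos, hmono, hspec, -⟩ := MCHPeakon.exists_bvpSpectrum_eq (hmx.mass_pos 0) (x 0)
  refine ⟨ζ, hpos, hmono, fun t => ?_⟩
  have ht := (hmx.bvpSpectrum_eq t 0).trans hspec
  refine ⟨ht, MCHPeakon.memH1_peakon _ _, ?_⟩
  -- The reciprocal sum is needed at time `t`; `ξ` equals `ζ` because both enumerate the same set
  -- increasingly.
  obtain ⟨ξ, -, hξmono, hξ, hsum⟩ := MCHPeakon.exists_bvpSpectrum_eq (hmx.mass_pos t) (x t)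
  have hrange : Set.range ξ = Set.range ζ := by
    have := hξ.symm.trans ht
    refine Complex.ofReal_injective.image_injective ?_
    rw [← Set.range_comp, ← Set.range_comp]
    exact this
  rw [← (hξmono.range_inj hmono).1 hrange, hsum,
    MCHPeakon.h1Norm_peakon_sq_of_strictMono _ (hmx.ordered t)]
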